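/- Consider a fully connected gossip network of $n\ge 1$ nodes and a source whose state $Q(t)\in\{1,2\}$ is a continuous-time Markov chain with rates $q_{12}>0$ (from $1$ to $2$) and $q_{21}>0$ (from $2$ to $1$). The source keeps a version number that increases by one at each transition of $Q$. Each node stores a packet, which consists of a version number and a content in $\{1,2\}$. Independently of everything else, the source sends its current packet (its version and $Q(t)$) to each node at the times of a Poisson process of rate $\lambda_s/n$, where $\lambda_s>0$, and the node always accepts it. For each ordered pair of distinct nodes $(i,j)$, node $i$ sends its packet to node $j$ at the times of a Poisson process of rate $\lambda/(n-1)$, and node $j$ replaces its packet by it if and only if the incoming version is more recent. Initially the versions stored at the nodes do not exceed that of the source, packets of the source's current version contain the current source state, and packets with equal versions have equal contents. Let $C_i(t)=1$ if the content stored at node $i$ at time $t$ equals $Q(t)$, and $C_i(t)=0$ otherwise. For a nonempty set $A$ of nodes put $C_A(t)=\frac1{|A|}\sum_{i\in A}C_i(t)$. Write $\mu=\lambda_s/n$, $s=q_{12}+q_{21}$, $\pi_1=q_{21}/s$, $\pi_2=q_{12}/s$. For every $\lambda>0$ the mode-tagged average accuracies and the average accuracy $$c^{(m)}=\lim_{t\to\infty}\mathbb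 E\bigl[C_A(t)\mathbf 1_{\{Q(t)=m\}}\bigr]\quad(m=1,2),\qquad c=\lim_{t\to\infty}\mathbb E[C_A(t)]=c^{(1)}+c^{(2)}$$ exist and depend neither on $A$ nor on the initial state. Let $\mathbf c=[c^{(1)},c^{(2)}]^T$. Fix $q_{12},q_{21},n$ and $\lambda_s$. In the no-gossip limit $\lambda\to0^+$, the limit of $\mathbf c$ exists and satisfies $$\begin{bmatrix} q_{12}+\mu & q_{21}\\ q_{12} & q_{21}+\mu\end{bmatrix}\lim_{\lambda\to0}\mathbf c=\begin{bmatrix} q_{21}\pi_2+\mu\pi_1\\ q_{12}\pi_1+\mu\pi_2\end{bmatrix},\qquad \lim_{\lambda\to0}\mathbf c=\frac1{s(s+\mu)}\begin{bmatrix} q_{21}(q_{21}+\mu)\\ q_{12}(q_{12}+\mu)\end{bmatrix},$$ and $$\lim_{\lambda\to0}c=\frac{\mu(q_{12}+q_{21})+q_{12}^2+q_{21}^2}{(q_{12}+q_{21})(q_{12}+q_{21}+\mu)}.$$ -/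

import Mathlib

open Filter Topology MeasureTheory

/-- The rates of a gossip network of `n` nodes with a binary source: the source jumps from state 1
to state 2 at rate `q12` and back at rate `q21`, pushes its packet at total rate `pushRate`, and
every node gossips at total rate `gossipRate`. -/
structure GossipRates (n : ℕ) where
  q12 : ℝ
  q21 : ℝ
  pushRate : ℝ
  gossipRate : ℝ
  q12_pos : 0 < q12
  q21_pos : 0 < q21
  pushRate_pos : 0 < pushRate
  gossipRate_nonneg : 0 ≤ gossipRate

/-- The state of the network. Source states are indexed by `Fin 2`: `0` is state 1 and `1` is
state 2. `source` is `Q`, `sourceVersion` is `V₀`, and node `i` stores a packet with version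
`version i` (that is `Vᵢ`) and content `content i` (that is `Sᵢ`). -/
structure GossipState (n : ℕ) where
  source : Fin 2
  sourceVersion : ℕ
  version : Fin n → ℕ
  content : Fin n → Fin 2

/-- The stored packets could have been issued by the source: no packet is newer than the source's
current version, packets of the current version hold the current source state, and packets of
equal version have equal content. -/
def GossipState.Admissible {n : ℕ} (z : GossipState n) : Prop :=
  (∀ i, z.version i ≤ z.sourceVersion) ∧
  (∀ i, z.version i = z.sourceVersion → z.content i = z.source) ∧
  (∀ i j, z.version i = z.version j → z.content i = z.content j)

/-- The events: a source transition 1 → 2 or 2 → 1, a push from the source to node `j`, and a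
gossip packet sent from node `p.1` to node `p.2`, for an ordered pair of distinct nodes. -/
inductive GossipEvent (n : ℕ) where
  | flip12 : GossipEvent n
  | flip21 : GossipEvent n
  | push (j : Fin n) : GossipEvent n
  | gossip (p : {p : Fin n × Fin n // p.1 ≠ p.2}) : GossipEvent n
  deriving DecidableEq, Fintype

instance (n : ℕ) : MeasurableSpace (GossipEvent n) := ⊤

namespace GossipEvent

/-- The state of the network right after an event. A clock tick for the source transition
1 → 2 has an effect only if the source is in state 1 (likewise for 2 → 1), so it produces
transitions at the mode-dependent rate. Every source transition creates a new version. A gossip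
packet is accepted if and only if it is strictly fresher than the receiver's packet. -/
def apply {n : ℕ} : GossipEvent n → GossipState n → GossipState n
  | flip12, z =>
      if z.source = 0 then { z with source := 1, sourceVersion := z.sourceVersion + 1 } else z
  | flip21, z =>
      if z.source = 1 then { z with source := 0, sourceVersion := z.sourceVersion + 1 } else z
  | push j, z =>
      { z with
        version := Function.update z.version j z.sourceVersion
        content := Function.update z.content j z.source }
  | gossip p, z =>
      if z.version p.1.2 < z.version p.1.1 then
        { z with
          version := Function.update z.version p.1.2 (z.version p.1.1)
          content := Function.update z.content p.1.2 (z.content p.1.1) }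
      else z

end GossipEvent

namespace GossipRates

variable {n : ℕ} (r : GossipRates n)

/-- The rate of the Poisson clock of each event. -/
noncomputable def eventRate : GossipEvent n → ℝ
  | .flip12 => r.q12
  | .flip21 => r.q21
  | .push _ => r.pushRate / n
  | .gossip _ => r.gossipRate / ((n : ℝ) - 1)

/-- The rate of the superposition of all the clocks. -/
noncomputable def totalRate : ℝ := ∑ e, r.eventRate e

theorem eventRate_nonneg (e : GossipEvent n) : 0 ≤ r.eventRate e := by
  cases e with
  | flip12 => exact r.q12_pos.le
  | flip21 => exact r.q21_pos.le
  | push j => exact div_nonneg r.pushRate_pos.le (Nat.cast_nonneg n)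
  | gossip p =>
    have h1 : 1 ≤ n := Nat.succ_le_of_lt (lt_of_le_of_lt (Nat.zero_le _) p.1.1.isLt)
    have h2 : (1 : ℝ) ≤ n := by exact_mod_cast h1
    exact div_nonneg r.gossipRate_nonneg (by linarith)

theorem totalRate_pos : 0 < r.totalRate :=
  Finset.sum_pos' (fun e _ => r.eventRate_nonneg e)
    ⟨GossipEvent.flip12, Finset.mem_univ _, r.q12_pos⟩

/-- The type of a tick of the superposed clock: it is `e` with probability
`eventRate e / totalRate`. -/
noncomputable def eventLaw : PMF (GossipEvent n) :=
  PMF.normalize (fun e => ENNReal.ofReal (r.eventRate e))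
    (by
      intro h
      have h0 := ENNReal.tsum_eq_zero.1 h GossipEvent.flip12
      exact absurd r.q12_pos (not_lt.2 (ENNReal.ofReal_eq_zero.1 h0)))
    (by
      rw [tsum_fintype]
      exact ENNReal.sum_ne_top.2 fun e _ => ENNReal.ofReal_ne_top)

/-- The joint law of one waiting time of the superposed clock and the type of the tick that ends
it: they are independent, and the waiting time is exponential. -/
noncomputable def tickLaw : Measure (ℝ × GossipEvent n) :=
  (ProbabilityTheory.expMeasure r.totalRate).prod r.eventLaw.toMeasure

instance : IsProbabilityMeasure r.tickLaw := by
  have := ProbabilityTheory.isProbabilityMeasure_expMeasure r.totalRate_pos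
  unfold tickLaw
  infer_instance

/-- The law of the driving noise: independent ticks. By thinning and superposition of Poisson
processes, the ticks of type `e` form independent Poisson processes of rates `eventRate e`. -/
noncomputable def noise : Measure (ℕ → ℝ × GossipEvent n) :=
  Measure.infinitePi fun _ => r.tickLaw

end GossipRates

namespace GossipState

variable {n : ℕ}

/-- The number of ticks up to time `t`: the least `k` such that tick number `k + 1` comes
after `t`. -/
noncomputable def tickCount (ω : ℕ → ℝ × GossipEvent n) (t : ℝ) : ℕ :=
  sInf {k : ℕ | t < ∑ i ∈ Finset.range (k + 1), (ω i).1}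

/-- The state of the network after the first `k` ticks, started from `z₀`. -/
def afterTicks (z₀ : GossipState n) (ω : ℕ → ℝ × GossipEvent n) : ℕ → GossipState n
  | 0 => z₀
  | k + 1 => (ω k).2.apply (afterTicks z₀ ω k)

/-- The state of the network at time `t`, started from `z₀` at time `0`. -/
noncomputable def atTime (z₀ : GossipState n) (t : ℝ) (ω : ℕ → ℝ × GossipEvent n) :
    GossipState n :=
  z₀.afterTicks ω (tickCount ω t)

/-- The accuracy `Cᵢ` of node `i`: whether its content is the current source state. -/
def nodeAccuracy (z : GossipState n) (i : Fin n) : ℝ :=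
  if z.content i = z.source then 1 else 0

/-- The accuracy `C_A` of a set `A` of nodes: the fraction of accurate nodes in `A`. -/
noncomputable def setAccuracy (z : GossipState n) (A : Finset (Fin n)) : ℝ :=
  (∑ i ∈ A, z.nodeAccuracy i) / A.card

end GossipState

/-- `E[C_A(t)]` for the network with rates `r` started from `z₀`. -/
noncomputable def expectedAccuracy {n : ℕ} (r : GossipRates n) (z₀ : GossipState n)
    (A : Finset (Fin n)) (t : ℝ) : ℝ :=
  ∫ ω, (z₀.atTime t ω).setAccuracy A ∂r.noise

/-- `E[C_A(t) 1{Q(t) = m}]` for the network with rates `r` started from `z₀`. -/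
noncomputable def expectedModeAccuracy {n : ℕ} (r : GossipRates n) (z₀ : GossipState n)
    (A : Finset (Fin n)) (m : Fin 2) (t : ℝ) : ℝ :=
  ∫ ω, (z₀.atTime t ω).setAccuracy A * (if (z₀.atTime t ω).source = m then 1 else 0) ∂r.noise

/-- The stationary distribution of the binary source. -/
noncomputable def sourceStationary (q12 q21 : ℝ) : Fin 2 → ℝ :=
  ![q21 / (q12 + q21), q12 / (q12 + q21)]

/-! Observed at the ticks of the superposed clock, the network is a Markov chain with averaging
operator `step`. Versions grow without bound, so the full state does not settle, but accuracies do
not see a common shift of all versions. On such functions a Doeblin argument works: the word "source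
transition 1 → 2, then a push to every node" takes every state to the same state up to a shift, and
it has positive probability. Each block of that length therefore contracts oscillations by a fixed
factor below 1, so the powers of `step` converge to a constant independent of the initial state
(`exists_tendsto_step_pow`). Renaming nodes preserves the dynamics, so this constant is the same for
every node.

Waiting times are independent of event types, and the number of ticks up to time `t` tends to
infinity almost surely. Dominated convergence then gives the same limit in continuous time
(`tendsto_integral_atTime`).

For small gossip rate λ, let `x a b` be the limiting probability that the source is in `a` and a
node holds `b`. In the limit the generator averages to 0 (`tendsto_step_pow_generator`). Source
transitions and pushes contribute a closed linear system in `x`, while gossip contributes at most λ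
times a constant depending only on `n` (`stationary_equations`). Eliminating the off-diagonal
entries through the source marginals leaves a 2 × 2 system for `x 0 0` and `x 1 1`, with error O(λ)
and determinant μ(s + μ) ≠ 0. Cramer's rule gives the limit, so no continuity of a stationary law in
λ is needed. -/

namespace GossipRates

/-! ### The embedded jump chain and its contraction along a word of events. -/

variable {n : ℕ} (r : GossipRates n)

/-- The probability that a tick of the superposed clock is of type `e`. -/
noncomputable def eventProb (e : GossipEvent n) : ℝ := r.eventRate e / r.totalRate

theorem eventProb_nonneg (e : GossipEvent n) : 0 ≤ r.eventProb e :=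
  div_nonneg (r.eventRate_nonneg e) r.totalRate_pos.le

theorem sum_eventProb : ∑ e, r.eventProb e = 1 := by
  unfold eventProb
  rw [← Finset.sum_div]
  exact div_self r.totalRate_pos.ne'

/-- The transition operator of the embedded jump chain. -/
noncomputable def step : Module.End ℝ (GossipState n → ℝ) where
  toFun f z := ∑ e, r.eventProb e * f (e.apply z)
  map_add' f g := by
    funext z
    simp only [Pi.add_apply, mul_add, Finset.sum_add_distrib]
  map_smul' c f := by
    funext z
    simp only [Pi.smul_apply, smul_eq_mul, RingHom.id_apply, Finset.mul_sum]
    exact Finset.sum_congr rfl fun e _ => by ring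

theorem step_apply (f : GossipState n → ℝ) (z : GossipState n) :
    r.step f z = ∑ e, r.eventProb e * f (e.apply z) := rfl

theorem step_pow_succ (k : ℕ) (f : GossipState n → ℝ) (z : GossipState n) :
    (r.step ^ (k + 1)) f z = ∑ e, r.eventProb e * (r.step ^ k) f (e.apply z) := by
  rw [pow_succ']
  rfl

theorem step_const (c : ℝ) : r.step (fun _ => c) = fun _ => c := by
  funext z
  rw [step_apply, ← Finset.sum_mul, sum_eventProb, one_mul]

theorem step_pow_const (c : ℝ) (k : ℕ) : (r.step ^ k) (fun _ => c) = fun _ => c := by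
  induction k with
  | zero => rfl
  | succ k ih =>
    rw [pow_succ, Module.End.mul_apply, step_const, ih]

/-- Each application of `step` replaces values by convex combinations of values, which stay in the
interval of radius `ε` around `a`. -/
theorem abs_step_pow_sub_le {g : GossipState n → ℝ} {a ε : ℝ} (h : ∀ z, |g z - a| ≤ ε) (k : ℕ) :
    ∀ z, |(r.step ^ k) g z - a| ≤ ε := by
  induction k with
  | zero => exact h
  | succ k ih =>
    intro z
    have h1 : (r.step ^ (k + 1)) g z - a =
        ∑ e, r.eventProb e * ((r.step ^ k) g (e.apply z) - a) := by
      simp only [mul_sub, Finset.sum_sub_distrib, ← Finset.sum_mul, sum_eventProb, one_mul,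
        step_pow_succ]
    rw [h1]
    calc _ ≤ ∑ e, |r.eventProb e * ((r.step ^ k) g (e.apply z) - a)| :=
          Finset.abs_sum_le_sum_abs _ _
      _ ≤ ∑ e, r.eventProb e * ε := by
          refine Finset.sum_le_sum fun e _ => ?_
          rw [abs_mul, abs_of_nonneg (r.eventProb_nonneg e)]
          exact mul_le_mul_of_nonneg_left (ih _) (r.eventProb_nonneg e)
      _ = ε := by rw [← Finset.sum_mul, sum_eventProb, one_mul]

theorem abs_step_pow_le {g : GossipState n → ℝ} {B : ℝ} (h : ∀ z, |g z| ≤ B) (k : ℕ)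
    (z : GossipState n) : |(r.step ^ k) g z| ≤ B := by
  simpa using r.abs_step_pow_sub_le (a := 0) (by simpa using h) k z

/-- The interval bound is used twice: once with the second state frozen, once with the first. -/
theorem abs_step_pow_sub_step_pow_le {f : GossipState n → ℝ} {D : ℝ}
    (hD : ∀ z z', |f z - f z'| ≤ D) (k : ℕ) (z z' : GossipState n) :
    |(r.step ^ k) f z - (r.step ^ k) f z'| ≤ D := by
  refine r.abs_step_pow_sub_le (fun x => ?_) k z
  rw [abs_sub_comm]
  exact r.abs_step_pow_sub_le (fun y => hD y x) k z'

/-- The state of the network after a list of events. -/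
def _root_.GossipState.afterList (z : GossipState n) (w : List (GossipEvent n)) : GossipState n :=
  w.foldl (fun z e => e.apply z) z

/-- If a word of events merges the values of `f`, the transition operator contracts the
oscillation of `f` by the probability of the word. -/
theorem abs_step_pow_length_sub_le {f : GossipState n → ℝ} {D : ℝ}
    (hD : ∀ z z', |f z - f z'| ≤ D) (w : List (GossipEvent n)) :
    ∀ z z' : GossipState n, f (z.afterList w) = f (z'.afterList w) →
      |(r.step ^ w.length) f z - (r.step ^ w.length) f z'| ≤
        (1 - (w.map r.eventProb).prod) * D := by
  induction w with
  | nil =>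
    intro z z' h
    have : f z = f z' := h
    simp [this]
  | cons e w ih =>
    intro z z' h
    have h1 : (r.step ^ (w.length + 1)) f z - (r.step ^ (w.length + 1)) f z' =
        ∑ e', r.eventProb e' *
          ((r.step ^ w.length) f (e'.apply z) - (r.step ^ w.length) f (e'.apply z')) := by
      simp only [mul_sub, Finset.sum_sub_distrib, step_pow_succ]
    rw [List.length_cons, h1, List.map_cons, List.prod_cons]
    calc _ ≤ ∑ e', |r.eventProb e' *
            ((r.step ^ w.length) f (e'.apply z) - (r.step ^ w.length) f (e'.apply z'))| :=
          Finset.abs_sum_le_sum_abs _ _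
      -- Only the branch in which both copies follow the word gains over the trivial bound `D`;
      -- every other first event is charged the full oscillation.
      _ ≤ ∑ e', (r.eventProb e' * D -
            if e' = e then r.eventProb e * (w.map r.eventProb).prod * D else 0) := by
          refine Finset.sum_le_sum fun e' _ => ?_
          rw [abs_mul, abs_of_nonneg (r.eventProb_nonneg e')]
          split_ifs with he
          · subst he
            have := mul_le_mul_of_nonneg_left (ih (e'.apply z) (e'.apply z') h)
              (r.eventProb_nonneg e')
            linarith
          · rw [sub_zero]
            exact mul_le_mul_of_nonneg_left (r.abs_step_pow_sub_step_pow_le hD _ _ _)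
              (r.eventProb_nonneg e')
      _ = _ := by
          rw [Finset.sum_sub_distrib, ← Finset.sum_mul, sum_eventProb,
            Finset.sum_ite_eq' Finset.univ e]
          simp only [Finset.mem_univ, if_true]
          ring

end GossipRates

/-! ### Invariance under version shifts and the synchronising word. -/

namespace GossipState

variable {n : ℕ}

/-- All versions raised by `d`. -/
def raise (d : ℕ) (z : GossipState n) : GossipState n :=
  { z with sourceVersion := z.sourceVersion + d, version := fun i => z.version i + d }

/-- Events only compare versions, copy them or add one, and all three commute with a common shift.
-/
theorem _root_.GossipEvent.apply_raise (e : GossipEvent n) (d : ℕ) (z : GossipState n) :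
    e.apply (z.raise d) = (e.apply z).raise d := by
  cases e with
  | flip12 =>
    by_cases h : z.source = 0 <;> simp [GossipEvent.apply, raise, h, Nat.add_right_comm]
  | flip21 =>
    by_cases h : z.source = 1 <;> simp [GossipEvent.apply, raise, h, Nat.add_right_comm]
  | push j =>
    simp only [GossipEvent.apply, raise, GossipState.mk.injEq, true_and, and_true]
    funext i
    by_cases h : i = j <;> simp [h]
  | gossip p =>
    by_cases h : z.version p.1.2 < z.version p.1.1
    · simp only [GossipEvent.apply, raise, add_lt_add_iff_right, h, if_true,
        GossipState.mk.injEq, true_and, and_true]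
      funext i
      by_cases h : i = p.1.2 <;> simp [h]
    · simp [GossipEvent.apply, raise, h]

/-- A function of the state that does not see a common shift of the versions. -/
def RaiseInvariant (f : GossipState n → ℝ) : Prop := ∀ d z, f (raise d z) = f z

theorem RaiseInvariant.step_pow {f : GossipState n → ℝ} (hf : RaiseInvariant f)
    (r : GossipRates n) (k : ℕ) : RaiseInvariant ((r.step ^ k) f) := by
  induction k with
  | zero => exact hf
  | succ k ih =>
    intro d z
    simp only [GossipRates.step_pow_succ, GossipEvent.apply_raise, ih d]

/-- The state in which the source is in state 2 and all the nodes are up to date. -/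
def synced (n : ℕ) : GossipState n := ⟨1, 0, fun _ => 0, fun _ => 1⟩

/-- A source transition to state 2 followed by a push to every node. -/
def syncWord (n : ℕ) : List (GossipEvent n) :=
  .flip12 :: (List.finRange n).map .push

theorem afterList_push (l : List (Fin n)) (z : GossipState n) :
    z.afterList (l.map .push) = { z with
      version := fun i => if i ∈ l then z.sourceVersion else z.version i
      content := fun i => if i ∈ l then z.source else z.content i } := by
  induction l generalizing z with
  | nil => simp [afterList]
  | cons j l ih =>
    have : z.afterList ((j :: l).map .push) =
      ((GossipEvent.push j).apply z).afterList (l.map .push) := rfl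
    rw [this, ih]
    simp only [GossipEvent.apply, GossipState.mk.injEq, true_and]
    constructor <;> funext i <;> by_cases h : i ∈ l <;> by_cases h' : i = j <;>
      simp [h, h']

/-- After a `flip12` tick the source is in state 2 whatever it was before, and the pushes overwrite
every packet. Only the source's version remembers the past, and it becomes the shift `d`. -/
theorem exists_afterList_syncWord (z : GossipState n) :
    ∃ d, z.afterList (syncWord n) = raise d (synced n) := by
  have h0 : z.afterList (syncWord n) =
    (GossipEvent.flip12.apply z).afterList ((List.finRange n).map .push) := rfl
  have h1 : (GossipEvent.flip12.apply z).source = 1 := by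
    by_cases h : z.source = 0
    · simp [GossipEvent.apply, h]
    · have : z.source = 1 := by omega
      simp [GossipEvent.apply, this]
  refine ⟨(GossipEvent.flip12.apply z).sourceVersion, ?_⟩
  rw [h0, afterList_push]
  simp [raise, synced, h1]

end GossipState

/-! ### Geometric ergodicity of the jump chain. -/

namespace GossipRates

open GossipState

variable {n : ℕ} (r : GossipRates n)

theorem syncWord_prob_pos : 0 < ((syncWord n).map r.eventProb).prod := by
  refine List.prod_pos fun a ha => ?_
  obtain ⟨e, he, rfl⟩ := List.mem_map.1 ha
  refine div_pos ?_ r.totalRate_pos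
  rcases List.mem_cons.1 he with rfl | he
  · exact r.q12_pos
  · obtain ⟨j, -, rfl⟩ := List.mem_map.1 he
    exact div_pos r.pushRate_pos (Nat.cast_pos.2 (Fin.pos j))

theorem eventProb_le_one (e : GossipEvent n) : r.eventProb e ≤ 1 := by
  rw [← r.sum_eventProb]
  exact Finset.single_le_sum (fun e _ => r.eventProb_nonneg e) (Finset.mem_univ e)

theorem prod_eventProb_le_one (w : List (GossipEvent n)) : (w.map r.eventProb).prod ≤ 1 := by
  induction w with
  | nil => simp
  | cons e w ih =>
    rw [List.map_cons, List.prod_cons]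
    exact mul_le_one₀ (r.eventProb_le_one e)
      (List.prod_nonneg fun a ha => by
        obtain ⟨e, -, rfl⟩ := List.mem_map.1 ha
        exact r.eventProb_nonneg e) ih

/-- The synchronising word leads any two states to shifts of one state, where a shift-invariant
function takes a single value. Each block of its length thus contracts the oscillation once more. -/
theorem abs_step_pow_mul_sub_le {f : GossipState n → ℝ} (hf : RaiseInvariant f) {D : ℝ}
    (hD : ∀ z z', |f z - f z'| ≤ D) (j : ℕ) :
    ∀ z z', |(r.step ^ ((syncWord n).length * j)) f z - (r.step ^ ((syncWord n).length * j)) f z'| ≤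
      (1 - ((syncWord n).map r.eventProb).prod) ^ j * D := by
  induction j with
  | zero => simpa using hD
  | succ j ih =>
    intro z z'
    have h1 : (r.step ^ ((syncWord n).length * (j + 1))) f =
        (r.step ^ (syncWord n).length) ((r.step ^ ((syncWord n).length * j)) f) := by
      rw [← Module.End.mul_apply, ← pow_add, mul_add, mul_one, add_comm]
    rw [h1, pow_succ', mul_assoc]
    refine r.abs_step_pow_length_sub_le ih _ _ _ ?_
    obtain ⟨d, hd⟩ := exists_afterList_syncWord z
    obtain ⟨d', hd'⟩ := exists_afterList_syncWord z'
    rw [hd, hd', hf.step_pow r, hf.step_pow r]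

/-- The embedded jump chain is ergodic for the functions of the state that do not see a common
shift of the versions. -/
theorem exists_tendsto_step_pow {f : GossipState n → ℝ} (hf : RaiseInvariant f) {B : ℝ}
    (hB : ∀ z, |f z| ≤ B) :
    ∃ c, ∀ z, Tendsto (fun k => (r.step ^ k) f z) atTop (𝓝 c) := by
  have hD : ∀ z z', |f z - f z'| ≤ 2 * B := fun z z' => by
    have h1 := abs_sub (f z) (f z')
    linarith [hB z, hB z']
  -- Later iterates are averages of the values of iterate `K`, whose oscillation is already small.
  -- The bound is uniform in both states, so it yields the Cauchy property and the independence of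
  -- the initial state.
  have key : ∀ ε > 0, ∃ K, ∀ k ≥ K, ∀ z z', |(r.step ^ k) f z - (r.step ^ K) f z'| ≤ ε := by
    intro ε hε
    have hlim : Tendsto (fun j : ℕ => (1 - ((syncWord n).map r.eventProb).prod) ^ j * (2 * B))
        atTop (𝓝 0) := by
      have := (tendsto_pow_atTop_nhds_zero_of_lt_one
        (sub_nonneg.2 (r.prod_eventProb_le_one _))
        (sub_lt_self 1 r.syncWord_prob_pos)).mul_const (2 * B)
      simpa using this
    obtain ⟨j, hj⟩ := (hlim.eventually (gt_mem_nhds hε)).exists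
    refine ⟨(syncWord n).length * j, fun k hk z z' => ?_⟩
    obtain ⟨i, rfl⟩ := Nat.exists_eq_add_of_le hk
    rw [add_comm, pow_add, Module.End.mul_apply]
    exact r.abs_step_pow_sub_le
      (fun x => (r.abs_step_pow_mul_sub_le hf hD j x z').trans hj.le) i z
  have hc : CauchySeq fun k => (r.step ^ k) f (synced n) := by
    refine Metric.cauchySeq_iff'.2 fun ε hε => ?_
    obtain ⟨K, hK⟩ := key (ε / 2) (half_pos hε)
    exact ⟨K, fun k hk => by
      rw [Real.dist_eq]
      exact (hK k hk _ _).trans_lt (half_lt_self hε)⟩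
  obtain ⟨c, hc⟩ := cauchySeq_tendsto_of_complete hc
  refine ⟨c, fun z => ?_⟩
  have h0 : Tendsto (fun k => (r.step ^ k) f z - (r.step ^ k) f (synced n)) atTop (𝓝 0) := by
    refine Metric.tendsto_atTop.2 fun ε hε => ?_
    obtain ⟨K, hK⟩ := key (ε / 3) (by linarith)
    refine ⟨K, fun k hk => ?_⟩
    rw [Real.dist_eq, sub_zero]
    have h1 := hK k hk z z
    have h2 := hK k hk (synced n) z
    rw [abs_sub_comm] at h2
    have h3 := abs_sub_le ((r.step ^ k) f z) ((r.step ^ K) f z) ((r.step ^ k) f (synced n))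
    linarith
  simpa using h0.add hc

end GossipRates

/-! ### Symmetry between the nodes. -/

namespace GossipState

variable {n : ℕ}

/-- The network with the nodes renamed by `σ`. -/
def rename (σ : Equiv.Perm (Fin n)) (z : GossipState n) : GossipState n :=
  { z with version := z.version ∘ σ, content := z.content ∘ σ }

/-- The events with the nodes renamed by `σ`. -/
def _root_.GossipEvent.rename (σ : Equiv.Perm (Fin n)) : GossipEvent n → GossipEvent n
  | .flip12 => .flip12
  | .flip21 => .flip21
  | .push j => .push (σ j)
  | .gossip p => .gossip ⟨(σ p.1.1, σ p.1.2), fun h => p.2 (σ.injective h)⟩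

/-- Renaming the nodes as a permutation of the events. -/
def _root_.GossipEvent.renameEquiv (σ : Equiv.Perm (Fin n)) : Equiv.Perm (GossipEvent n) where
  toFun := GossipEvent.rename σ
  invFun := GossipEvent.rename σ.symm
  left_inv e := by cases e <;> simp [GossipEvent.rename]
  right_inv e := by cases e <;> simp [GossipEvent.rename]

theorem _root_.GossipEvent.apply_rename (σ : Equiv.Perm (Fin n)) (e : GossipEvent n)
    (z : GossipState n) : e.apply (z.rename σ) = ((e.rename σ).apply z).rename σ := by
  cases e with
  | flip12 => by_cases h : z.source = 0 <;> simp [GossipEvent.apply, GossipEvent.rename, rename, h]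
  | flip21 => by_cases h : z.source = 1 <;> simp [GossipEvent.apply, GossipEvent.rename, rename, h]
  | push j =>
    simp only [GossipEvent.apply, GossipEvent.rename, rename, GossipState.mk.injEq, true_and]
    constructor <;> funext i <;> by_cases h : i = j <;> simp [h]
  | gossip p =>
    by_cases h : z.version (σ p.1.2) < z.version (σ p.1.1)
    · simp only [GossipEvent.apply, GossipEvent.rename, rename, Function.comp_apply, h, if_true,
        GossipState.mk.injEq, true_and]
      constructor <;> funext i <;> by_cases h : i = p.1.2 <;> simp [h]
    · simp [GossipEvent.apply, GossipEvent.rename, rename, h]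

/-- Event rates do not depend on node names, so renaming merely permutes the sum over events. -/
theorem step_pow_comp_rename (r : GossipRates n) (σ : Equiv.Perm (Fin n)) (f : GossipState n → ℝ)
    (k : ℕ) (z : GossipState n) :
    (r.step ^ k) (fun z => f (z.rename σ)) z = (r.step ^ k) f (z.rename σ) := by
  induction k generalizing z with
  | zero => rfl
  | succ k ih =>
    rw [GossipRates.step_pow_succ, GossipRates.step_pow_succ]
    simp only [ih, GossipEvent.apply_rename]
    refine (Equiv.sum_comp (GossipEvent.renameEquiv σ) _).symm.trans ?_
    refine Finset.sum_congr rfl fun e _ => ?_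
    have : r.eventProb (GossipEvent.renameEquiv σ e) = r.eventProb e := by
      cases e <;> rfl
    rw [this]
    rfl

/-- The indicator of the event that the source is in state `a` and node `i` holds content `b`. -/
def indicator (i : Fin n) (a b : Fin 2) (z : GossipState n) : ℝ :=
  if z.source = a ∧ z.content i = b then 1 else 0

theorem indicator_raiseInvariant (i : Fin n) (a b : Fin 2) : RaiseInvariant (indicator i a b) :=
  fun _ _ => rfl

theorem abs_indicator_le (i : Fin n) (a b : Fin 2) (z : GossipState n) :
    |indicator i a b z| ≤ 1 := by
  unfold indicator
  split_ifs <;> simp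

end GossipState

open GossipState in
/-- The stationary probability that the source is in state `a` and a given node holds `b`: it
depends neither on the node nor on the initial state. -/
theorem GossipRates.exists_tendsto_indicator {n : ℕ} (r : GossipRates n) (hn : 1 ≤ n)
    (a b : Fin 2) :
    ∃ c, ∀ i z, Tendsto (fun k => (r.step ^ k) (indicator i a b) z) atTop (𝓝 c) := by
  obtain ⟨c, hc⟩ := r.exists_tendsto_step_pow (indicator_raiseInvariant ⟨0, hn⟩ a b)
    (abs_indicator_le ⟨0, hn⟩ a b)
  refine ⟨c, fun i z => ?_⟩
  have h1 : indicator i a b =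
      fun z => indicator ⟨0, hn⟩ a b (z.rename (Equiv.swap ⟨0, hn⟩ i)) := by
    funext z
    simp [indicator, rename]
  rw [h1]
  simp only [step_pow_comp_rename]
  exact hc _

/-! ### Independence of the waiting times and the event types. -/

/-- The whole space is a square cylinder of finite mass. -/
def finiteSpanningSetsInSquareCylinders {γ : Type*} [MeasurableSpace γ] (ρ : Measure (ℕ → γ))
    [IsProbabilityMeasure ρ] :
    ρ.FiniteSpanningSetsIn (squareCylinders fun _ : ℕ => {s : Set γ | MeasurableSet s}) where
  set _ := Set.univ
  set_mem _ := ⟨∅, fun _ => Set.univ, by simp, by simp⟩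
  finite _ := measure_lt_top _ _
  spanning := Set.iUnion_const _

/-- A sequence of independent pairs with independent components is a pair of independent
sequences. -/
theorem infinitePi_prod_map_unzip {α β : Type*} [MeasurableSpace α] [MeasurableSpace β]
    (μ : Measure α) (ν : Measure β) [IsProbabilityMeasure μ] [IsProbabilityMeasure ν] :
    (Measure.infinitePi fun _ : ℕ => μ.prod ν).map
        (fun ω => ((fun i => (ω i).1 : ℕ → α), (fun i => (ω i).2 : ℕ → β))) =
      (Measure.infinitePi fun _ => μ).prod (Measure.infinitePi fun _ => ν) := by
  refine (Measure.prod_eq_generateFrom generateFrom_squareCylinders generateFrom_squareCylinders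
    (isPiSystem_squareCylinders (fun _ => MeasurableSpace.isPiSystem_measurableSet) (by simp))
    (isPiSystem_squareCylinders (fun _ => MeasurableSpace.isPiSystem_measurableSet) (by simp))
    (finiteSpanningSetsInSquareCylinders _) (finiteSpanningSetsInSquareCylinders _) ?_).symm
  rintro _ ⟨s, A, hA, rfl⟩ _ ⟨t, B, hB, rfl⟩
  have hA' : ∀ i, MeasurableSet (A i) := fun i => hA i (Set.mem_univ i)
  have hB' : ∀ i, MeasurableSet (B i) := fun i => hB i (Set.mem_univ i)
  have hmeas : Measurable (fun ω : ℕ → α × β =>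
      ((fun i => (ω i).1 : ℕ → α), (fun i => (ω i).2 : ℕ → β))) := by fun_prop
  have hS : MeasurableSet ((s : Set ℕ).pi A) := .pi s.countable_toSet fun i _ => hA' i
  have hT : MeasurableSet ((t : Set ℕ).pi B) := .pi t.countable_toSet fun i _ => hB' i
  -- Padding with `Set.univ` puts both cylinders over the common index set `s ∪ t`, so that their
  -- product is a cylinder of rectangles.
  let A' : ℕ → Set α := fun i => if i ∈ s then A i else Set.univ
  let B' : ℕ → Set β := fun i => if i ∈ t then B i else Set.univ
  have hA'' : ∀ i, MeasurableSet (A' i) := fun i => by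
    by_cases h : i ∈ s <;> simp [A', h, hA']
  have hB'' : ∀ i, MeasurableSet (B' i) := fun i => by
    by_cases h : i ∈ t <;> simp [B', h, hB']
  have h1 : ((s : Set ℕ).pi A) = ((s ∪ t : Finset ℕ) : Set ℕ).pi A' := by
    ext x
    simp only [Set.mem_pi, Finset.mem_coe, Finset.mem_union, A']
    refine ⟨fun h i _ => ?_, fun h i hi => ?_⟩
    · split_ifs with hi
      · exact h i hi
      · trivial
    · simpa [hi] using h i (Or.inl hi)
  have h2 : ((t : Set ℕ).pi B) = ((s ∪ t : Finset ℕ) : Set ℕ).pi B' := by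
    ext x
    simp only [Set.mem_pi, Finset.mem_coe, Finset.mem_union, B']
    refine ⟨fun h i _ => ?_, fun h i hi => ?_⟩
    · split_ifs with hi
      · exact h i hi
      · trivial
    · simpa [hi] using h i (Or.inr hi)
  have h3 : (fun ω : ℕ → α × β =>
      ((fun i => (ω i).1 : ℕ → α), (fun i => (ω i).2 : ℕ → β))) ⁻¹'
        (((s : Set ℕ).pi A) ×ˢ ((t : Set ℕ).pi B)) =
      ((s ∪ t : Finset ℕ) : Set ℕ).pi fun i => A' i ×ˢ B' i := by
    rw [h1, h2]
    ext ω
    simp only [Set.mem_preimage, Set.mem_prod, Set.mem_pi]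
    exact ⟨fun h i hi => ⟨h.1 i hi, h.2 i hi⟩, fun h => ⟨fun i hi => (h i hi).1,
      fun i hi => (h i hi).2⟩⟩
  rw [Measure.map_apply hmeas (hS.prod hT), h3,
    Measure.infinitePi_pi _ fun i _ => (hA'' i).prod (hB'' i), h1, h2,
    Measure.infinitePi_pi _ fun i _ => hA'' i, Measure.infinitePi_pi _ fun i _ => hB'' i,
    ← Finset.prod_mul_distrib]
  exact Finset.prod_congr rfl fun i _ => Measure.prod_prod _ _

namespace GossipRates

variable {n : ℕ} (r : GossipRates n)

theorem eventLaw_toReal (e : GossipEvent n) : (r.eventLaw e).toReal = r.eventProb e := by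
  have h1 : ∑' e, ENNReal.ofReal (r.eventRate e) = ENNReal.ofReal r.totalRate := by
    rw [tsum_fintype, totalRate, ENNReal.ofReal_sum_of_nonneg fun e _ => r.eventRate_nonneg e]
  rw [eventLaw, PMF.normalize_apply, h1, ENNReal.toReal_mul, ENNReal.toReal_inv,
    ENNReal.toReal_ofReal (r.eventRate_nonneg e), ENNReal.toReal_ofReal r.totalRate_pos.le]
  rfl

/-- The law of the types of the ticks. -/
noncomputable def markNoise : Measure (ℕ → GossipEvent n) :=
  Measure.infinitePi fun _ => r.eventLaw.toMeasure

instance : IsProbabilityMeasure r.markNoise := by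
  unfold markNoise
  infer_instance

/-- The law of the waiting times. -/
noncomputable def timeNoise : Measure (ℕ → ℝ) :=
  Measure.infinitePi fun _ => ProbabilityTheory.expMeasure r.totalRate

instance : IsProbabilityMeasure (ProbabilityTheory.expMeasure r.totalRate) :=
  ProbabilityTheory.isProbabilityMeasure_expMeasure r.totalRate_pos

instance : IsProbabilityMeasure r.timeNoise := by
  unfold timeNoise
  infer_instance

theorem noise_map_unzip :
    r.noise.map (fun ω => ((fun i => (ω i).1 : ℕ → ℝ), (fun i => (ω i).2 : ℕ → GossipEvent n))) =
      r.timeNoise.prod r.markNoise :=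
  infinitePi_prod_map_unzip _ _

end GossipRates

/-! ### Expectations along the jump chain as powers of `step`. -/

namespace GossipState

variable {n : ℕ}

/-- The state of the network after the first `k` events of a sequence. -/
def afterEvents (z : GossipState n) (m : ℕ → GossipEvent n) : ℕ → GossipState n
  | 0 => z
  | k + 1 => (m k).apply (afterEvents z m k)

theorem afterTicks_eq_afterEvents (z : GossipState n) (ω : ℕ → ℝ × GossipEvent n) (k : ℕ) :
    z.afterTicks ω k = z.afterEvents (fun i => (ω i).2) k := by
  induction k with
  | zero => rfl
  | succ k ih => rw [afterTicks, afterEvents, ih]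

theorem afterEvents_congr (z : GossipState n) {m m' : ℕ → GossipEvent n} {k : ℕ}
    (h : ∀ i < k, m i = m' i) : z.afterEvents m k = z.afterEvents m' k := by
  induction k with
  | zero => rfl
  | succ k ih =>
    rw [afterEvents, afterEvents, ih fun i hi => h i (hi.trans k.lt_succ_self),
      h k k.lt_succ_self]

/-- The state after `k` events as a function of these events alone. -/
theorem exists_afterEvents_eq (z : GossipState n) (k : ℕ) :
    ∃ φ : (Finset.range k → GossipEvent n) → GossipState n,
      ∀ m, z.afterEvents m k = φ fun i => m i := by
  refine ⟨fun v => z.afterEvents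
    (fun i => if h : i ∈ Finset.range k then v ⟨i, h⟩ else .flip12) k, fun m => ?_⟩
  refine afterEvents_congr z fun i hi => ?_
  simp [hi]

/-- The state space needs no σ-algebra: the value factors through finitely many coordinates in a
finite discrete type. -/
theorem measurable_afterEvents (z : GossipState n) (f : GossipState n → ℝ) (k : ℕ) :
    Measurable fun m : ℕ → GossipEvent n => f (z.afterEvents m k) := by
  obtain ⟨φ, hφ⟩ := exists_afterEvents_eq z k
  simp only [hφ]
  have h1 : Measurable fun v : Finset.range k → GossipEvent n => f (φ v) :=
    measurable_of_countable _
  exact h1.comp (by fun_prop)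

end GossipState

namespace GossipRates

open GossipState

variable {n : ℕ} (r : GossipRates n)

theorem integrable_afterEvents (z : GossipState n) {f : GossipState n → ℝ} {B : ℝ}
    (hB : ∀ z, |f z| ≤ B) (k : ℕ) :
    Integrable (fun m => f (z.afterEvents m k)) r.markNoise :=
  Integrable.of_bound (measurable_afterEvents z f k).aestronglyMeasurable B
    (ae_of_all _ fun _ => hB _)

/-- The state after `k` events depends on events `0, …, k - 1` only, hence is independent of event
`k`. -/
theorem integral_indicator_mul_afterEvents (z : GossipState n) (f : GossipState n → ℝ) (k : ℕ)
    (e : GossipEvent n) :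
    ∫ m, (if m k = e then 1 else 0) * f (z.afterEvents m k) ∂r.markNoise =
      r.eventProb e * ∫ m, f (z.afterEvents m k) ∂r.markNoise := by
  obtain ⟨φ, hφ⟩ := exists_afterEvents_eq z k
  have hind : ProbabilityTheory.iIndepFun (fun (i : ℕ) (m : ℕ → GossipEvent n) => m i)
      r.markNoise :=
    ProbabilityTheory.iIndepFun_infinitePi (P := fun _ : ℕ => r.eventLaw.toMeasure)
      (X := fun _ x => x) (fun _ => measurable_id)
  have h1 := hind.indepFun_finset {k} (Finset.range k) (by simp) (fun i => measurable_pi_apply i)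
  have h2 : ProbabilityTheory.IndepFun
      (fun m : ℕ → GossipEvent n => if m k = e then (1 : ℝ) else 0)
      (fun m => f (z.afterEvents m k)) r.markNoise := by
    simp only [hφ]
    exact h1.comp
      (φ := fun v : ({k} : Finset ℕ) → GossipEvent n =>
        if v ⟨k, Finset.mem_singleton_self k⟩ = e then (1 : ℝ) else 0)
      (ψ := fun v : Finset.range k → GossipEvent n => f (φ v))
      (measurable_of_countable _) (measurable_of_countable _)
  have h3 : Measurable fun m : ℕ → GossipEvent n => if m k = e then (1 : ℝ) else 0 :=
    (measurable_of_countable fun x : GossipEvent n => if x = e then (1 : ℝ) else 0).comp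
      (measurable_pi_apply k)
  rw [h2.integral_fun_mul_eq_mul_integral h3.aestronglyMeasurable
    (measurable_afterEvents z f k).aestronglyMeasurable]
  congr 1
  have h4 : (fun m : ℕ → GossipEvent n => if m k = e then (1 : ℝ) else 0) =
      ((fun m : ℕ → GossipEvent n => m k) ⁻¹' {e}).indicator 1 := by
    funext m
    by_cases h : m k = e <;> simp [h]
  rw [h4, integral_indicator_one (measurable_pi_apply k (MeasurableSet.of_discrete (s := {e}))),
    Measure.real,
    ← Measure.map_apply (measurable_pi_apply k) .of_discrete, markNoise]
  have h5 := Measure.infinitePi_map_eval (fun _ : ℕ => r.eventLaw.toMeasure) k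
  have h6 : Measure.map (fun m : ℕ → GossipEvent n => m k)
      (Measure.infinitePi fun _ => r.eventLaw.toMeasure) = r.eventLaw.toMeasure := h5
  rw [h6, PMF.toMeasure_apply_singleton _ _ .of_discrete, eventLaw_toReal]

/-- Averaging over the last event turns `f` after `k + 1` events into `step f` after `k` events, so
the induction must allow `f` to vary. -/
theorem integral_afterEvents (z : GossipState n) {f : GossipState n → ℝ} {B : ℝ}
    (hB : ∀ z, |f z| ≤ B) (k : ℕ) :
    ∫ m, f (z.afterEvents m k) ∂r.markNoise = (r.step ^ k) f z := by
  induction k generalizing f with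
  | zero => simp [afterEvents]
  | succ k ih =>
    have h1 : ∀ m : ℕ → GossipEvent n, f (z.afterEvents m (k + 1)) =
        ∑ e, (if m k = e then 1 else 0) * (fun x => f (e.apply x)) (z.afterEvents m k) := by
      intro m
      simp [afterEvents]
    have hint : ∀ e : GossipEvent n, Integrable (fun m : ℕ → GossipEvent n =>
        (if m k = e then 1 else 0) * (fun x => f (e.apply x)) (z.afterEvents m k))
        r.markNoise := by
      intro e
      refine Integrable.of_bound (C := B) (Measurable.aestronglyMeasurable ?_)
        (ae_of_all _ fun m => ?_)
      · exact ((measurable_of_countable fun x : GossipEvent n =>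
          if x = e then (1 : ℝ) else 0).comp (measurable_pi_apply k)).mul
          (measurable_afterEvents z (fun x => f (e.apply x)) k)
      · have := (abs_nonneg _).trans (hB z)
        split_ifs <;> simp [hB, this]
    have h2 : ∀ x, r.step f x = ∑ e, r.eventProb e * f (e.apply x) := fun x => rfl
    simp only [h1]
    rw [integral_finsetSum _ fun e _ => hint e]
    rw [pow_succ, Module.End.mul_apply, ← ih (f := r.step f) fun x => r.abs_step_pow_le hB 1 x,
      Finset.sum_congr rfl fun e _ =>
        r.integral_indicator_mul_afterEvents z (fun x => f (e.apply x)) k e]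
    simp only [h2]
    rw [integral_finsetSum]
    · simp only [integral_const_mul]
    · exact fun e _ => (r.integrable_afterEvents z (fun x => hB (e.apply x)) k).const_mul _

/-! ### Divergence of the number of ticks and passage to continuous time. -/

/-- The number of ticks up to time `t` in terms of the waiting times. -/
noncomputable def _root_.GossipState.renewalCount (T : ℕ → ℝ) (t : ℝ) : ℕ :=
  sInf {k : ℕ | t < ∑ i ∈ Finset.range (k + 1), T i}

theorem _root_.GossipState.measurable_renewalCount (t : ℝ) :
    Measurable fun T : ℕ → ℝ => renewalCount T t := by
  refine measurable_of_Ioi fun k => ?_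
  have hm : ∀ j, MeasurableSet {T : ℕ → ℝ | t < ∑ i ∈ Finset.range (j + 1), T i} := fun j =>
    measurableSet_lt measurable_const (by fun_prop)
  -- The union says that the defining set is nonempty. It cannot be dropped, since `sInf ∅ = 0` in
  -- `ℕ`.
  have : (fun T : ℕ → ℝ => renewalCount T t) ⁻¹' Set.Ioi k =
      (⋃ j, {T : ℕ → ℝ | t < ∑ i ∈ Finset.range (j + 1), T i}) ∩
        ⋂ j ≤ k, {T : ℕ → ℝ | t < ∑ i ∈ Finset.range (j + 1), T i}ᶜ := by
    ext T
    simp only [Set.mem_preimage, Set.mem_Ioi, Set.mem_inter_iff, Set.mem_iUnion, Set.mem_iInter,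
      Set.mem_compl_iff, Set.mem_ofPred_eq]
    constructor
    · intro h
      refine ⟨?_, fun j hj hjT => ?_⟩
      · obtain ⟨j, hj⟩ := Nat.nonempty_of_pos_sInf ((Nat.zero_le k).trans_lt h)
        exact ⟨j, hj⟩
      · exact absurd (Nat.sInf_le (show j ∈ {k : ℕ | t < ∑ i ∈ Finset.range (k + 1), T i} from hjT))
          (not_le.2 (hj.trans_lt h))
    · rintro ⟨⟨j, hj⟩, h⟩
      by_contra hk
      exact h _ (not_lt.1 hk) (Nat.sInf_mem
        (s := {k : ℕ | t < ∑ i ∈ Finset.range (k + 1), T i}) ⟨j, hj⟩)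
  rw [this]
  exact (MeasurableSet.iUnion hm).inter
    (MeasurableSet.iInter fun j => MeasurableSet.iInter fun _ => (hm j).compl)

/-- Infinitely many waiting times above 1 make the partial sums unbounded, so the infimum is
attained at every time. Once `t` passes the sum of the first `K` waiting times, the count is at
least `K`. -/
theorem _root_.GossipState.tendsto_renewalCount {T : ℕ → ℝ} (h0 : ∀ i, 0 < T i)
    (h1 : ∀ k, ∃ i ≥ k, 1 < T i) : Tendsto (renewalCount T) atTop atTop := by
  have hub : ∀ M : ℕ, ∃ k, (M : ℝ) ≤ ∑ i ∈ Finset.range k, T i := by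
    intro M
    induction M with
    | zero => exact ⟨0, by simp⟩
    | succ M ih =>
      obtain ⟨k, hk⟩ := ih
      obtain ⟨i, hi, hT⟩ := h1 k
      refine ⟨i + 1, ?_⟩
      have := Finset.sum_le_sum_of_subset_of_nonneg (Finset.range_mono hi)
        (f := T) fun j _ _ => (h0 j).le
      rw [Finset.sum_range_succ]
      push_cast
      linarith
  have hmono : ∀ a b, a ≤ b → ∑ i ∈ Finset.range a, T i ≤ ∑ i ∈ Finset.range b, T i :=
    fun a b hab => Finset.sum_le_sum_of_subset_of_nonneg (Finset.range_mono hab)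
      fun j _ _ => (h0 j).le
  refine tendsto_atTop.2 fun K => ?_
  filter_upwards [eventually_ge_atTop (∑ i ∈ Finset.range K, T i)] with t ht
  have hne : {k : ℕ | t < ∑ i ∈ Finset.range (k + 1), T i}.Nonempty := by
    obtain ⟨M, hM⟩ := exists_nat_gt t
    obtain ⟨k, hk⟩ := hub M
    exact ⟨k, hM.trans_le (hk.trans (hmono _ _ k.le_succ))⟩
  refine le_csInf hne fun k hk => ?_
  by_contra hlt
  exact absurd (hk.trans_le ((hmono _ _ (not_le.1 hlt)).trans ht)) (lt_irrefl _)

theorem ae_tendsto_renewalCount :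
    ∀ᵐ T ∂r.timeNoise, Tendsto (renewalCount T) atTop atTop := by
  have hcdf : ∀ x, (ProbabilityTheory.expMeasure r.totalRate) (Set.Iic x) =
      ENNReal.ofReal (if 0 ≤ x then 1 - Real.exp (-(r.totalRate * x)) else 0) := by
    intro x
    rw [← ProbabilityTheory.cdf_expMeasure_eq r.totalRate_pos, ProbabilityTheory.ofReal_cdf]
  have h0 : ∀ᵐ T ∂r.timeNoise, ∀ i, 0 < T i := by
    refine ae_all_iff.2 fun i => ?_
    have h1 : ∀ᵐ x ∂(ProbabilityTheory.expMeasure r.totalRate), 0 < x := by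
      rw [ae_iff]
      simp only [not_lt]
      exact (hcdf 0).trans (by simp)
    exact (measurePreserving_eval_infinitePi
      (fun _ : ℕ => ProbabilityTheory.expMeasure r.totalRate) i).quasiMeasurePreserving.ae h1
  have h1 : ∀ᵐ T ∂r.timeNoise, ∀ k, ∃ i ≥ k, 1 < T i := by
    refine ae_all_iff.2 fun k => ?_
    rw [ae_iff]
    set q := (ProbabilityTheory.expMeasure r.totalRate) (Set.Iic 1) with hq
    have hq1 : q < 1 := by
      rw [hq, hcdf 1, if_pos zero_le_one, ENNReal.ofReal_lt_one]
      linarith [Real.exp_pos (-(r.totalRate * 1))]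
    -- No waiting time above 1 from index `k` on forces the next `j` of them to be at most 1, an
    -- event of probability `q ^ j`.
    have hle : ∀ j : ℕ, r.timeNoise {T | ¬∃ i ≥ k, 1 < T i} ≤ q ^ j := by
      intro j
      have h2 : r.timeNoise (((Finset.Ico k (k + j) : Finset ℕ) : Set ℕ).pi
          fun _ => Set.Iic (1 : ℝ)) = q ^ j := by
        rw [timeNoise, Measure.infinitePi_pi _ fun i _ => measurableSet_Iic]
        simp [hq]
      rw [← h2]
      refine measure_mono fun T hT i hi => ?_
      by_contra hlt
      exact hT ⟨i, (Finset.mem_Ico.1 (Finset.mem_coe.1 hi)).1, not_le.1 hlt⟩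
    exact le_antisymm (ge_of_tendsto' (ENNReal.tendsto_pow_atTop_nhds_zero_of_lt_one hq1) hle)
      zero_le
  filter_upwards [h0, h1] with T hT0 hT1
  exact tendsto_renewalCount hT0 hT1

theorem measurable_atTime (z : GossipState n) (f : GossipState n → ℝ) (t : ℝ) :
    Measurable fun p : (ℕ → ℝ) × (ℕ → GossipEvent n) =>
      f (z.afterEvents p.2 (renewalCount p.1 t)) := by
  have h1 : Measurable fun p : ℕ × (ℕ → GossipEvent n) => f (z.afterEvents p.2 p.1) :=
    measurable_from_prod_countable_right fun k => measurable_afterEvents z f k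
  exact h1.comp (((measurable_renewalCount t).comp measurable_fst).prodMk measurable_snd)

/-- Fubini: with the waiting times frozen, the number of ticks is a constant and only the event
types are averaged. -/
theorem integral_atTime (z : GossipState n) {f : GossipState n → ℝ} {B : ℝ}
    (hB : ∀ z, |f z| ≤ B) (t : ℝ) :
    ∫ ω, f (z.atTime t ω) ∂r.noise =
      ∫ T, (r.step ^ (renewalCount T t)) f z ∂r.timeNoise := by
  have h1 : ∀ ω : ℕ → ℝ × GossipEvent n, f (z.atTime t ω) =
      (fun p : (ℕ → ℝ) × (ℕ → GossipEvent n) => f (z.afterEvents p.2 (renewalCount p.1 t)))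
        ((fun i => (ω i).1), fun i => (ω i).2) := by
    intro ω
    rw [atTime, afterTicks_eq_afterEvents]
    rfl
  simp only [h1]
  have hm := measurable_atTime z f t
  rw [← integral_map (φ := fun ω : ℕ → ℝ × GossipEvent n =>
      ((fun i => (ω i).1 : ℕ → ℝ), (fun i => (ω i).2 : ℕ → GossipEvent n)))
      (f := fun p : (ℕ → ℝ) × (ℕ → GossipEvent n) => f (z.afterEvents p.2 (renewalCount p.1 t)))
      (Measurable.aemeasurable (by fun_prop)) hm.aestronglyMeasurable, noise_map_unzip,
    integral_prod _ (Integrable.of_bound hm.aestronglyMeasurable B (ae_of_all _ fun _ => hB _))]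
  simp only [r.integral_afterEvents z hB]

/-- If the expectation along the embedded jump chain converges, so does the expectation along the
continuous-time chain. -/
theorem tendsto_integral_atTime (z : GossipState n) {f : GossipState n → ℝ} {B c : ℝ}
    (hB : ∀ z, |f z| ≤ B) (hc : Tendsto (fun k => (r.step ^ k) f z) atTop (𝓝 c)) :
    Tendsto (fun t => ∫ ω, f (z.atTime t ω) ∂r.noise) atTop (𝓝 c) := by
  simp only [r.integral_atTime z hB]
  have h1 : Tendsto (fun t => ∫ T, (r.step ^ (renewalCount T t)) f z ∂r.timeNoise) atTop
      (𝓝 (∫ _, c ∂r.timeNoise)) := by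
    refine tendsto_integral_filter_of_dominated_convergence (fun _ => B) ?_ ?_
      (integrable_const _) ?_
    · refine Eventually.of_forall fun t => Measurable.aestronglyMeasurable ?_
      exact (measurable_of_countable fun k : ℕ => (r.step ^ k) f z).comp
        (measurable_renewalCount t)
    · exact Eventually.of_forall fun t => ae_of_all _ fun T => r.abs_step_pow_le hB _ _
    · filter_upwards [r.ae_tendsto_renewalCount] with T hT
      exact hc.comp hT
  simpa using h1

end GossipRates

/-! ### The generator and the stationarity equations. -/

/-- The events sorted by kind. -/
def GossipEvent.equivSum (n : ℕ) :
    GossipEvent n ≃ (Unit ⊕ Unit) ⊕ (Fin n ⊕ {p : Fin n × Fin n // p.1 ≠ p.2}) where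
  toFun
    | .flip12 => .inl (.inl ())
    | .flip21 => .inl (.inr ())
    | .push j => .inr (.inl j)
    | .gossip p => .inr (.inr p)
  invFun
    | .inl (.inl _) => .flip12
    | .inl (.inr _) => .flip21
    | .inr (.inl j) => .push j
    | .inr (.inr p) => .gossip p
  left_inv e := by cases e <;> rfl
  right_inv e := by rcases e with (_ | _) | (_ | _) <;> rfl

theorem GossipEvent.sum_eq {n : ℕ} (g : GossipEvent n → ℝ) :
    ∑ e, g e = g .flip12 + g .flip21 + ∑ j, g (.push j) + ∑ p, g (.gossip p) := by
  rw [← Equiv.sum_comp (GossipEvent.equivSum n).symm g, Fintype.sum_sum_type,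
    Fintype.sum_sum_type, Fintype.sum_sum_type]
  simp [GossipEvent.equivSum, add_assoc]

namespace GossipRates

open GossipState

variable {n : ℕ} (r : GossipRates n)

/-- The generator of the continuous-time chain. -/
noncomputable def generator (f : GossipState n → ℝ) (z : GossipState n) : ℝ :=
  ∑ e, r.eventRate e * (f (e.apply z) - f z)

/-- The contribution of the gossip events to the generator. -/
noncomputable def gossipGenerator (f : GossipState n → ℝ) (z : GossipState n) : ℝ :=
  ∑ p, r.eventRate (.gossip p) * (f ((GossipEvent.gossip p).apply z) - f z)

theorem generator_eq (f : GossipState n → ℝ) :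
    r.generator f = r.totalRate • (r.step f - f) := by
  funext z
  simp only [generator, Pi.smul_apply, Pi.sub_apply, smul_eq_mul, step_apply, mul_sub,
    Finset.sum_sub_distrib, Finset.mul_sum, eventProb]
  congr 1
  · refine Finset.sum_congr rfl fun e _ => ?_
    have := r.totalRate_pos.ne'
    field_simp
  · rw [← Finset.sum_mul, totalRate]

/-- The generator is `totalRate` times `step - 1`, so its averages are multiples of differences of
consecutive terms of a convergent sequence. -/
theorem tendsto_step_pow_generator {f : GossipState n → ℝ} {z : GossipState n} {c : ℝ}
    (h : Tendsto (fun k => (r.step ^ k) f z) atTop (𝓝 c)) :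
    Tendsto (fun k => (r.step ^ k) (r.generator f) z) atTop (𝓝 0) := by
  have h1 : ∀ k, (r.step ^ k) (r.generator f) z =
      r.totalRate * ((r.step ^ (k + 1)) f z - (r.step ^ k) f z) := by
    intro k
    rw [generator_eq, map_smul, map_sub, pow_succ]
    rfl
  simp only [h1]
  have h2 := ((h.comp (tendsto_add_atTop_nat 1)).sub h).const_mul r.totalRate
  simpa using h2

/-- Twice the rate at which gossip packets are sent, per unit of gossip rate. -/
noncomputable def _root_.GossipState.gossipBound (n : ℕ) : ℝ :=
  ∑ _p : {p : Fin n × Fin n // p.1 ≠ p.2}, 2 / ((n : ℝ) - 1)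

theorem abs_gossipGenerator_le {f : GossipState n → ℝ} (hf : ∀ z, |f z| ≤ 1)
    (z : GossipState n) : |r.gossipGenerator f z| ≤ r.gossipRate * gossipBound n := by
  refine (Finset.abs_sum_le_sum_abs _ _).trans ?_
  rw [gossipBound, Finset.mul_sum]
  refine Finset.sum_le_sum fun p _ => ?_
  rw [abs_mul, abs_of_nonneg (r.eventRate_nonneg _)]
  have h1 : |f ((GossipEvent.gossip p).apply z) - f z| ≤ 2 := by
    have h2 := abs_sub (f ((GossipEvent.gossip p).apply z)) (f z)
    linarith [hf z, hf ((GossipEvent.gossip p).apply z)]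
  refine (mul_le_mul_of_nonneg_left h1 (r.eventRate_nonneg _)).trans_eq ?_
  simp only [eventRate]
  ring

theorem sum_push_indicator (i : Fin n) (a b : Fin 2) (z : GossipState n) :
    ∑ j, r.eventRate (.push j) *
        (indicator i a b ((GossipEvent.push j).apply z) - indicator i a b z) =
      r.pushRate / n * ((if z.source = a ∧ z.source = b then 1 else 0) - indicator i a b z) := by
  rw [Finset.sum_eq_single i]
  · simp [eventRate, indicator, GossipEvent.apply]
  · intro j _ hj
    simp [indicator, GossipEvent.apply, Function.update_of_ne hj.symm]
  · simp

/-- The pair (source, content) = (0, 0) is entered from (1, 0) by a source transition and from (0,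
1) by a push, and left by a source transition; gossip is kept as a remainder. -/
theorem generator_indicator_zero (i : Fin n) :
    r.generator (indicator i 0 0) = r.q21 • indicator i 1 0 - r.q12 • indicator i 0 0 +
      (r.pushRate / n) • indicator i 0 1 + r.gossipGenerator (indicator i 0 0) := by
  funext z
  rw [generator, GossipEvent.sum_eq, sum_push_indicator]
  simp only [Pi.add_apply, Pi.sub_apply, Pi.smul_apply, smul_eq_mul, gossipGenerator,
    add_left_inj]
  have h1 : z.source = 0 ∨ z.source = 1 := by omega
  have h2 : z.content i = 0 ∨ z.content i = 1 := by omega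
  rcases h1 with h1 | h1 <;> rcases h2 with h2 | h2 <;>
    simp [indicator, GossipEvent.apply, eventRate, h1, h2]

theorem generator_indicator_one (i : Fin n) :
    r.generator (indicator i 1 1) = r.q12 • indicator i 0 1 - r.q21 • indicator i 1 1 +
      (r.pushRate / n) • indicator i 1 0 + r.gossipGenerator (indicator i 1 1) := by
  funext z
  rw [generator, GossipEvent.sum_eq, sum_push_indicator]
  simp only [Pi.add_apply, Pi.sub_apply, Pi.smul_apply, smul_eq_mul, gossipGenerator,
    add_left_inj]
  have h1 : z.source = 0 ∨ z.source = 1 := by omega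
  have h2 : z.content i = 0 ∨ z.content i = 1 := by omega
  rcases h1 with h1 | h1 <;> rcases h2 with h2 | h2 <;>
    simp [indicator, GossipEvent.apply, eventRate, h1, h2]

/-- Summing over the content leaves the indicator of the source being in state 1. Pushes and gossip
do not affect it, so its equation is exact. -/
theorem generator_source (i : Fin n) :
    r.generator (indicator i 0 0 + indicator i 0 1) =
      (fun _ => r.q21) - (r.q12 + r.q21) • (indicator i 0 0 + indicator i 0 1) := by
  have h0 : ∀ z : GossipState n, (indicator i 0 0 + indicator i 0 1) z =
      if z.source = 0 then 1 else 0 := by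
    intro z
    have h2 : z.content i = 0 ∨ z.content i = 1 := by omega
    rcases h2 with h2 | h2 <;> simp [indicator, h2]
  funext z
  rw [generator, GossipEvent.sum_eq]
  simp only [h0, Pi.sub_apply, Pi.smul_apply, smul_eq_mul]
  have h3 : ∀ p, ((GossipEvent.gossip p).apply z).source = z.source := by
    intro p
    simp only [GossipEvent.apply]
    split_ifs <;> rfl
  have h4 : ∀ j, ((GossipEvent.push j).apply z).source = z.source := fun j => rfl
  have h1 : z.source = 0 ∨ z.source = 1 := by omega
  simp only [h3, h4, sub_self, mul_zero, Finset.sum_const_zero, add_zero]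
  rcases h1 with h1 | h1 <;> simp [GossipEvent.apply, eventRate, h1]

/-- The stationarity equations of the pair (source state, content of a node), up to the
contribution of the gossip events. -/
theorem stationary_equations (i : Fin n) (z : GossipState n) {x : Fin 2 → Fin 2 → ℝ}
    (hx : ∀ a b, Tendsto (fun k => (r.step ^ k) (indicator i a b) z) atTop (𝓝 (x a b))) :
    x 0 0 + x 0 1 = r.q21 / (r.q12 + r.q21) ∧ x 1 0 + x 1 1 = r.q12 / (r.q12 + r.q21) ∧
      |r.q21 * x 1 0 - r.q12 * x 0 0 + r.pushRate / n * x 0 1| ≤ r.gossipRate * gossipBound n ∧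
      |r.q12 * x 0 1 - r.q21 * x 1 1 + r.pushRate / n * x 1 0| ≤
        r.gossipRate * gossipBound n := by
  have hs : 0 < r.q12 + r.q21 := add_pos r.q12_pos r.q21_pos
  have hsum : Tendsto (fun k => (r.step ^ k) (indicator i 0 0 + indicator i 0 1) z) atTop
      (𝓝 (x 0 0 + x 0 1)) := by
    simp only [map_add]
    exact (hx 0 0).add (hx 0 1)
  have h1 : x 0 0 + x 0 1 = r.q21 / (r.q12 + r.q21) := by
    have h2 := r.tendsto_step_pow_generator hsum
    simp only [generator_source, map_sub, map_smul, step_pow_const] at h2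
    have h3 := tendsto_nhds_unique h2 (tendsto_const_nhds.sub (hsum.const_mul (r.q12 + r.q21)))
    rw [eq_div_iff hs.ne']
    linarith
  have htot : x 0 0 + x 0 1 + (x 1 0 + x 1 1) = 1 := by
    have h2 : indicator i 0 0 + indicator i 0 1 + (indicator i 1 0 + indicator i 1 1) =
        fun _ => 1 := by
      funext z
      have h1 : z.source = 0 ∨ z.source = 1 := by omega
      have h2 : z.content i = 0 ∨ z.content i = 1 := by omega
      rcases h1 with h1 | h1 <;> rcases h2 with h2 | h2 <;> simp [indicator, h1, h2]
    have h3 : Tendsto (fun k => (r.step ^ k) (indicator i 0 0 + indicator i 0 1 +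
        (indicator i 1 0 + indicator i 1 1)) z) atTop
        (𝓝 (x 0 0 + x 0 1 + (x 1 0 + x 1 1))) := by
      simp only [map_add]
      exact ((hx 0 0).add (hx 0 1)).add ((hx 1 0).add (hx 1 1))
    simp only [h2, step_pow_const] at h3
    exact tendsto_nhds_unique h3 tendsto_const_nhds
  -- The full generator averages to 0 in the limit, so the part `g` without gossip tends to minus
  -- the gossip part, which is uniformly small.
  have hbound : ∀ (a b : Fin 2) (g : GossipState n → ℝ) (y : ℝ),
      r.generator (indicator i a b) = g + r.gossipGenerator (indicator i a b) →
      Tendsto (fun k => (r.step ^ k) g z) atTop (𝓝 y) →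
      |y| ≤ r.gossipRate * gossipBound n := by
    intro a b g y hg hy
    have h2 := (r.tendsto_step_pow_generator (hx a b)).sub hy
    have h3 : ∀ k, (r.step ^ k) (r.generator (indicator i a b)) z - (r.step ^ k) g z =
        (r.step ^ k) (r.gossipGenerator (indicator i a b)) z := by
      intro k
      rw [hg, map_add, Pi.add_apply, add_sub_cancel_left]
    simp only [h3] at h2
    have h4 := le_of_tendsto' h2.abs fun k =>
      r.abs_step_pow_le (r.abs_gossipGenerator_le (abs_indicator_le i a b)) k z
    simpa using h4
  refine ⟨h1, ?_, hbound 0 0 _ _ (r.generator_indicator_zero i) ?_,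
    hbound 1 1 _ _ (r.generator_indicator_one i) ?_⟩
  · have h2 : x 1 0 + x 1 1 = 1 - r.q21 / (r.q12 + r.q21) := by linarith
    rw [h2]
    field_simp
    ring
  · simp only [map_add, map_sub, map_smul]
    exact (((hx 1 0).const_mul _).sub ((hx 0 0).const_mul _)).add ((hx 0 1).const_mul _)
  · simp only [map_add, map_sub, map_smul]
    exact (((hx 0 1).const_mul _).sub ((hx 1 1).const_mul _)).add ((hx 1 0).const_mul _)

end GossipRates

/-! ### Accuracies of sets of nodes as averages of indicators. -/

namespace GossipState

variable {n : ℕ}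

theorem setAccuracy_mul_source (z : GossipState n) (A : Finset (Fin n)) (m : Fin 2) :
    z.setAccuracy A * (if z.source = m then 1 else 0) =
      (∑ i ∈ A, indicator i m m z) / A.card := by
  rw [setAccuracy, div_mul_eq_mul_div, Finset.sum_mul]
  congr 1
  refine Finset.sum_congr rfl fun i _ => ?_
  by_cases h : z.source = m
  · subst h
    simp [nodeAccuracy, indicator]
  · simp [indicator, h]

theorem setAccuracy_eq (z : GossipState n) (A : Finset (Fin n)) :
    z.setAccuracy A = (∑ i ∈ A, (indicator i 0 0 z + indicator i 1 1 z)) / A.card := by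
  rw [setAccuracy]
  congr 1
  refine Finset.sum_congr rfl fun i _ => ?_
  have h1 : z.source = 0 ∨ z.source = 1 := by omega
  rcases h1 with h1 | h1 <;> simp [nodeAccuracy, indicator, h1]

end GossipState

namespace GossipRates

open GossipState

variable {n : ℕ} (r : GossipRates n)

/-- Averaging over a nonempty set of nodes does not change a limit common to all the nodes. -/
theorem tendsto_integral_average (z : GossipState n) {A : Finset (Fin n)} (hA : A.Nonempty)
    {g : Fin n → GossipState n → ℝ} {c B : ℝ} (hg : ∀ i z, |g i z| ≤ B)
    (hc : ∀ i, Tendsto (fun k => (r.step ^ k) (g i) z) atTop (𝓝 c)) :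
    Tendsto (fun t => ∫ ω, (∑ i ∈ A, g i (z.atTime t ω)) / A.card ∂r.noise) atTop (𝓝 c) := by
  have hcard : (A.card : ℝ) ≠ 0 := Nat.cast_ne_zero.2 hA.card_pos.ne'
  have h0 : (fun z => (∑ i ∈ A, g i z) / A.card) = (A.card : ℝ)⁻¹ • ∑ i ∈ A, g i := by
    funext z
    simp [div_eq_inv_mul]
  refine r.tendsto_integral_atTime (f := fun z => (∑ i ∈ A, g i z) / A.card) (B := B) z
    (fun x => ?_) ?_
  · rw [abs_div, Nat.abs_cast, div_le_iff₀ (Nat.cast_pos.2 hA.card_pos)]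
    refine (Finset.abs_sum_le_sum_abs _ _).trans ((Finset.sum_le_sum fun i _ => hg i x).trans ?_)
    simp [mul_comm]
  · rw [h0]
    simp only [map_smul, map_sum, Pi.smul_apply, Finset.sum_apply, smul_eq_mul]
    have h1 := (tendsto_finsetSum A fun i _ => hc i).const_mul (A.card : ℝ)⁻¹
    simpa [hcard] using h1

end GossipRates

/-! ### The no-gossip limit. -/

/-- The two left-hand sides converge to `e` and `f`, and Cramer's rule expresses `u` and `v` as
fixed linear combinations of them. -/
theorem tendsto_of_abs_linear_system_le {a b c d K e f : ℝ} (hdet : a * d - b * c ≠ 0)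
    {u v : ℝ → ℝ} (h1 : ∀ l, 0 < l → |a * u l + b * v l - e| ≤ l * K)
    (h2 : ∀ l, 0 < l → |c * u l + d * v l - f| ≤ l * K) :
    Tendsto u (𝓝[>] 0) (𝓝 ((d * e - b * f) / (a * d - b * c))) ∧
      Tendsto v (𝓝[>] 0) (𝓝 ((a * f - c * e) / (a * d - b * c))) := by
  have hlim : Tendsto (fun l : ℝ => l * K) (𝓝[>] 0) (𝓝 0) := by
    have h : Tendsto (fun l : ℝ => l * K) (𝓝 0) (𝓝 (0 * K)) := tendsto_id.mul_const K
    rw [zero_mul] at h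
    exact h.mono_left nhdsWithin_le_nhds
  have hconv : ∀ {w : ℝ → ℝ} {g : ℝ}, (∀ l, 0 < l → |w l - g| ≤ l * K) →
      Tendsto w (𝓝[>] 0) (𝓝 g) := by
    intro w g h
    refine tendsto_iff_norm_sub_tendsto_zero.2 (squeeze_zero' (Eventually.of_forall fun _ =>
      norm_nonneg _) ?_ hlim)
    filter_upwards [self_mem_nhdsWithin] with l hl
    exact h l hl
  have he := hconv h1
  have hf := hconv h2
  constructor
  · refine (((he.const_mul d).sub (hf.const_mul b)).div_const _).congr fun l => ?_
    rw [div_eq_iff hdet]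
    ring
  · refine (((hf.const_mul a).sub (he.const_mul c)).div_const _).congr fun l => ?_
    rw [div_eq_iff hdet]
    ring

/-- `c lam m` is the mode-tagged average accuracy for gossip rate `lam`: the limit of
`E[C_A(t) 1{Q(t) = m}]` for every nonempty set `A` of nodes and every initial state. -/
theorem mainTheorem7 (n : ℕ) (hn : 1 ≤ n) (q12 q21 lams : ℝ)
    (h12 : 0 < q12) (h21 : 0 < q21) (hs : 0 < lams) (mu s : ℝ) (p : Fin 2 → ℝ)
    (hmu : mu = lams / n) (hsum : s = q12 + q21) (hp : p = sourceStationary q12 q21) :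
    ∃ c : ℝ → Fin 2 → ℝ,
      (∀ (lam : ℝ) (hlam : 0 < lam) (z₀ : GossipState n), z₀.Admissible →
        ∀ A : Finset (Fin n), A.Nonempty →
          (∀ m : Fin 2, Tendsto
            (expectedModeAccuracy ⟨q12, q21, lams, lam, h12, h21, hs, hlam.le⟩ z₀ A m)
            atTop (𝓝 (c lam m))) ∧
          Tendsto (expectedAccuracy ⟨q12, q21, lams, lam, h12, h21, hs, hlam.le⟩ z₀ A)
            atTop (𝓝 (c lam 0 + c lam 1))) ∧
      (∃ c₀ : Fin 2 → ℝ,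
        Tendsto c (𝓝[>] 0) (𝓝 c₀) ∧
        Matrix.mulVec !![q12 + mu, q21; q12, q21 + mu] c₀ =
          ![q21 * p 1 + mu * p 0, q12 * p 0 + mu * p 1] ∧
        c₀ = (1 / (s * (s + mu))) • ![q21 * (q21 + mu), q12 * (q12 + mu)]) ∧
      Tendsto (fun lam => c lam 0 + c lam 1) (𝓝[>] 0)
        (𝓝 ((mu * (q12 + q21) + q12 ^ 2 + q21 ^ 2) /
          ((q12 + q21) * (q12 + q21 + mu)))) := by
  have hmu0 : 0 < mu := hmu ▸ div_pos hs (Nat.cast_pos.2 hn)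
  have hs0 : 0 < s := hsum ▸ add_pos h12 h21
  let r : ∀ lam : ℝ, 0 < lam → GossipRates n :=
    fun lam hlam => ⟨q12, q21, lams, lam, h12, h21, hs, hlam.le⟩
  have hex : ∀ (lam : ℝ) (a b : Fin 2), ∃ x, ∀ (hlam : 0 < lam) (i : Fin n) (z : GossipState n),
      Tendsto (fun k => ((r lam hlam).step ^ k) (GossipState.indicator i a b) z) atTop (𝓝 x) := by
    intro lam a b
    by_cases hlam : 0 < lam
    · obtain ⟨x, hx⟩ := (r lam hlam).exists_tendsto_indicator hn a b
      exact ⟨x, fun _ => hx⟩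
    -- The value for nonpositive rates is arbitrary: the limit is taken from the right.
    · exact ⟨0, fun h => absurd h hlam⟩
  choose x hx using hex
  have heq : ∀ (lam : ℝ) (hlam : 0 < lam), _ := fun lam hlam =>
    (r lam hlam).stationary_equations ⟨0, hn⟩ (GossipState.synced n)
      (x := x lam) fun a b => hx lam a b hlam _ _
  have hp0 : p 0 = q21 / (q12 + q21) := by rw [hp]; rfl
  have hp1 : p 1 = q12 / (q12 + q21) := by rw [hp]; rfl
  have hdet : (q12 + mu) * (q21 + mu) - q21 * q12 = mu * (s + mu) := by rw [hsum]; ring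
  have hdet0 : mu * (s + mu) ≠ 0 := (mul_pos hmu0 (add_pos hs0 hmu0)).ne'
  obtain ⟨hc0, hc1⟩ := tendsto_of_abs_linear_system_le (a := q12 + mu) (b := q21) (c := q12)
    (d := q21 + mu) (K := GossipState.gossipBound n) (e := q21 * p 1 + mu * p 0)
    (f := q12 * p 0 + mu * p 1) (u := fun l => x l 0 0) (v := fun l => x l 1 1)
    (hdet.trans_ne hdet0)
    (fun l hl => by
      obtain ⟨e1, e2, e3, -⟩ := heq l hl
      rw [← abs_neg]
      refine (congrArg abs ?_).trans_le e3
      rw [hp0, hp1, hmu]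
      -- The source marginals `e1` and `e2` replace `x l 0 1` by `p 0 - x l 0 0` and `x l 1 0` by `p
      -- 1 - x l 1 1`.
      linear_combination (-lams / n) * e1 - q21 * e2)
    (fun l hl => by
      obtain ⟨e1, e2, -, e4⟩ := heq l hl
      rw [← abs_neg]
      refine (congrArg abs ?_).trans_le e4
      rw [hp0, hp1, hmu]
      linear_combination (-q12) * e1 - (lams / n) * e2)
  have hv0 : ((q21 + mu) * (q21 * p 1 + mu * p 0) - q21 * (q12 * p 0 + mu * p 1)) /
      ((q12 + mu) * (q21 + mu) - q21 * q12) = q21 * (q21 + mu) / (s * (s + mu)) := by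
    rw [hdet, hp0, hp1, ← hsum]
    have : s + mu ≠ 0 := (add_pos hs0 hmu0).ne'
    field_simp
    ring
  have hv1 : ((q12 + mu) * (q12 * p 0 + mu * p 1) - q12 * (q21 * p 1 + mu * p 0)) /
      ((q12 + mu) * (q21 + mu) - q21 * q12) = q12 * (q12 + mu) / (s * (s + mu)) := by
    rw [hdet, hp0, hp1, ← hsum]
    have : s + mu ≠ 0 := (add_pos hs0 hmu0).ne'
    field_simp
    ring
  rw [hv0] at hc0
  rw [hv1] at hc1
  have hne : s * (s + mu) ≠ 0 := (mul_pos hs0 (add_pos hs0 hmu0)).ne'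
  refine ⟨fun lam m => x lam m m, fun lam hlam z₀ _ A hA => ⟨fun m => ?_, ?_⟩,
    ⟨(1 / (s * (s + mu))) • ![q21 * (q21 + mu), q12 * (q12 + mu)], ?_, ?_, rfl⟩, ?_⟩
  · unfold expectedModeAccuracy
    simp only [GossipState.setAccuracy_mul_source]
    exact (r lam hlam).tendsto_integral_average z₀ hA
      (fun i => GossipState.abs_indicator_le i m m) fun i => hx lam m m hlam i z₀
  · unfold expectedAccuracy
    simp only [GossipState.setAccuracy_eq]
    refine (r lam hlam).tendsto_integral_average (B := 1 + 1) z₀ hA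
      (g := fun i => GossipState.indicator i 0 0 + GossipState.indicator i 1 1)
      (fun i z => (abs_add_le _ _).trans (add_le_add (GossipState.abs_indicator_le i 0 0 z)
        (GossipState.abs_indicator_le i 1 1 z))) fun i => ?_
    simp only [map_add]
    exact (hx lam 0 0 hlam i z₀).add (hx lam 1 1 hlam i z₀)
  · refine tendsto_pi_nhds.2 fun m => ?_
    fin_cases m
    · exact hc0.trans (by simp [div_eq_inv_mul])
    · exact hc1.trans (by simp [div_eq_inv_mul])
  · rw [hp0, hp1, ← hsum]
    have : s + mu ≠ 0 := (add_pos hs0 hmu0).ne'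
    ext m
    fin_cases m
    · simp [Matrix.mulVec, dotProduct, Fin.sum_univ_two]
      field_simp
      rw [hsum]
      ring
    · simp [Matrix.mulVec, dotProduct, Fin.sum_univ_two]
      field_simp
      rw [hsum]
      ring
  · refine (hc0.add hc1).trans (le_of_eq (congrArg 𝓝 ?_))
    rw [← add_div, hsum]
    congr 1
    ring
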